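/- **Coding Theorem for $quK^t$.** *Conventions.* A classical Turing machine $M$ is a one-tape machine over the alphabet $\{\square,0,1\}$ given by quadruples (state, scanned symbol, action, new state), the action being to write a symbol or to move the head by one cell; it halts when no quadruple applies, and its output is the bit string that starts at the head and ends before the first blank to the right. Its description $\langle M\rangle\in\{0,1\}^*$ consists of the length $w$ of a state name in unary (as $1^w0$), where $w$ is the number of binary digits of the largest state, followed by the list of its quadruples, a state being written with $w$ bits, a symbol with $2$ bits and an action with $3$ bits. $\mathcal U$ is a fixed (explicit, multi-stack) universal Turing machine: a program $\Pi$ that starts with the self-delimiting form $1b_1\,1b_2\cdots 1b_\ell\,0$ of $\langle M\rangle=b_1\cdots b_\ell$ makes $\mathcal U(\Pi,y)$ simulate $M$ on input $y$, the remaining bits of $\Pi$ being ignored. $\mathcal U^t(\Pi,y)$ is the output of $\mathcal U$ on $(\Pi,y)$ if $\mathcal U$ halts within $t$ of its own steps, and $\bot$ otherwise. A quantum circuit consists of a number of qubits, initially in the state $|0\cdots0\rangle$, a sequence of layers of gates from $\{H,T,\mathrm{CNOT}\}$ acting on pairwise disjoint qubits within each layer, and a number $m$ of outputs; the qubits are measured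 in the computational basis and the first $m$ results are output. Its depth is the number of layers, and circuits are encoded injectively as bit strings. $\mathsf{QU}^t(c)$ samples the output of the circuit encoded by $c$ if $c$ is the encoding of a circuit of depth at most $t$, and outputs $\bot$ otherwise (in particular if $c=\bot$). For $t:\mathbb N\to\mathbb N$, a *$t(n)$-time quantum algorithm* $\mathcal D$ is given by a classical Turing machine $M$ that halts on input $1^n$ within $t(n)$ steps for every $n$; on input $1^n$, $\mathcal D$ computes the output $c$ of $M$ on $1^n$ and outputs a sample of $\mathsf{QU}^{t(n)}(c)$. Its description length is $|\mathcal D|=|\langle M\rangle|$. The universal quantum sampler $\mathcal Q^{t}(1^n)$, for $t,n\in\mathbb N$, draws $\Pi\in\{0,1\}^t$ uniformly at random, computes $c=\mathcal U^t(\Pi,1^n)$, and outputs a sample of $\mathsf{QU}^t(c)$. For $x\in\{0,1\}^*$ put $$quK^t(x\mid 1^n)=-\log_2\Pr[x\leftarrow\mathcal Q^t(1^n)]\in[0,\infty].$$ *Theorem.* There are a universal constant $c$ and a polynomial $t_0$ such that for every function $t:\mathbb N\to\mathbb N$, every $t(n)$-time quantum algorithm $\mathcal D$, every $n\in\mathbb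 N$, every $x\in\{0,1\}^*$ and every integer $T>t_0(t(n))$, $$quK^{T}(x\mid 1^n)\le \log_2\frac1{\Pr[x\leftarrow\mathcal D(1^n)]}+2|\mathcal D|+c,$$ where $\log_2(1/0)=\infty$. -/

import Mathlib

open Turing
open scoped ENNReal

/-! ## Running a machine for a bounded number of steps -/

/-- The halting configuration reached from `c` after at most `t` steps, if there is one
(`step c = none` means that the configuration `c` is halted). -/
def haltsWithin {C : Type*} (step : C → Option C) : ℕ → C → Option C
  | 0, c => match step c with
    | none => some c
    | some _ => none
  | t + 1, c => match step c with
    | none => some c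
    | some c' => haltsWithin step t c'

/-- The bit string written on a half-tape over the alphabet `{□, 0, 1}` before the first blank. -/
def readBits : List (Option Bool) → List Bool
  | some b :: l => b :: readBits l
  | _ => []

theorem readBits_blank (l : List (Option Bool)) (n : ℕ) :
    readBits (l ++ List.replicate n none) = readBits l := by
  induction l with
  | nil => cases n <;> simp [readBits, List.replicate_succ]
  | cons a l ih => cases a <;> simp [readBits, ih]

/-! ## Classical Turing machines: one tape, alphabet `{□, 0, 1}`, quadruple form -/

/-- A Turing machine with `k + 1` states; state `0` is initial, `none` is the blank. In every step
it writes a symbol or moves its head, and it halts when no quadruple applies. -/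
abbrev BinTM (k : ℕ) : Type := TM0.Machine (Option Bool) (Fin (k + 1))

namespace BinTM

variable {k : ℕ}

/-- The output of `M` on input `y` if it halts within `t` steps: the bit string that starts at the
head and extends to the first blank on its right. -/
def run (M : BinTM k) (t : ℕ) (y : List Bool) : Option (List Bool) :=
  (haltsWithin (TM0.step M) t (TM0.init (y.map some))).map fun c =>
    c.Tape.right₀.liftOn readBits (by
      rintro a b ⟨n, rfl⟩
      exact (readBits_blank a n).symm)

/-- Two bits for a tape symbol. -/
def encodeSymbol : Option Bool → List Bool
  | none => [false, false]
  | some b => [true, b]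

/-- Three bits for an action. -/
def encodeAction : TM0.Stmt (Option Bool) → List Bool
  | .move .left => [false, false, false]
  | .move .right => [false, true, false]
  | .write a => true :: encodeSymbol a

/-- The binary expansion of `q` in `w` bits. -/
def encodeState (w q : ℕ) : List Bool := (List.range w).map q.testBit

/-- The description of `M`: the length `w` of a state name in unary, then the list of all quadruples
(state, scanned symbol, action, new state) of `M`. -/
def encode (M : BinTM k) : List Bool :=
  let w := Nat.size k
  List.replicate w true ++ false ::
    (List.finRange (k + 1)).flatMap fun q =>
      [none, some false, some true].flatMap fun s =>
        match M q s with
        | none => []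
        | some (q', a) => encodeState w q ++ encodeSymbol s ++ encodeAction a ++ encodeState w q'

end BinTM

/-! ## The universal Turing machine

A concrete machine with finitely many control states and eight stacks, each of which is a half-tape
over `{□, 0, 1}` with its head at the top. It reads pairs `1 b` from the program until the first `0`
in the place of a `1`, takes the bits `b` as the description of a machine `M`, ignores the rest of
the program, and simulates `M` on the input, one pass through the description for each step
of `M`. -/

namespace UTM

/-- `prog`: the program; `desc` and `back`: the part of the description that is still ahead and the
part already passed in the current pass; `state` and `aux`: the name of the current state; `next`:
the name of the next state; `left` and `right`: the tape of the simulated machine, with the scanned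
cell on top of `right`. -/
inductive Stack
  | prog | desc | back | state | aux | next | left | right
  deriving DecidableEq

instance : Fintype Stack where
  elems := {.prog, .desc, .back, .state, .aux, .next, .left, .right}
  complete := by rintro (_ | _) <;> decide

/-- The control labels. -/
inductive Label
  | parse | rewind | header | fetch | quad | compare | action | copy | finish | apply | clear
  | install
  deriving DecidableEq

instance : Fintype Label where
  elems := {.parse, .rewind, .header, .fetch, .quad, .compare, .action, .copy, .finish, .apply,
    .clear, .install}
  complete := by rintro (_ | _) <;> decide

/-- The finite memory of the control unit. -/
structure Reg where
  /-- the symbol popped last -/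
  bit : Option Bool
  /-- a bit of the name of the current state -/
  key : Option Bool
  /-- the symbol scanned by the simulated machine -/
  sym : Option Bool
  /-- whether the quadruple being read applies -/
  ok : Bool
  /-- whether a quadruple that applies has been found -/
  found : Bool
  /-- the action of that quadruple -/
  act₀ : Bool
  act₁ : Bool
  act₂ : Bool

theorem finite_reg : Finite Reg :=
  Finite.of_injective
    (fun v : Reg => (v.bit, v.key, v.sym, v.ok, v.found, v.act₀, v.act₁, v.act₂))
    (by rintro ⟨⟩ ⟨⟩ h; simpa using h)

/-- The initial memory. -/
def Reg.init : Reg := ⟨none, none, none, false, false, false, false, false⟩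

/-- Store the popped symbol; an empty stack shows a blank. -/
def setBit (v : Reg) (o : Option (Option Bool)) : Reg := { v with bit := o.join }

open TM2.Stmt in
/-- Move one bit of the description from `desc` to `back` through the register `bit`. -/
def advance (q : TM2.Stmt (fun _ : Stack => Option Bool) Label Reg) :
    TM2.Stmt (fun _ : Stack => Option Bool) Label Reg :=
  pop .desc setBit <| push .back (fun v => v.bit) q

open TM2.Stmt in
/-- The transition table of the universal machine. -/
def program : Label → TM2.Stmt (fun _ : Stack => Option Bool) Label Reg
  | .parse =>
      pop .prog setBit <|
      branch (fun v => v.bit == some true)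
        (pop .prog setBit <| push .back (fun v => v.bit) <| goto fun _ => .parse)
        (goto fun _ => .rewind)
  | .rewind =>
      pop .back setBit <|
      branch (fun v => v.bit.isSome)
        (push .desc (fun v => v.bit) <| goto fun _ => .rewind)
        (goto fun _ => .header)
  | .header =>
      pop .desc setBit <|
      branch (fun v => v.bit == some true)
        (push .state (fun _ => some false) <| goto fun _ => .header)
        (goto fun _ => .fetch)
  | .fetch =>
      peek .right (fun v o => { v with sym := o.join, found := false }) <|
      goto fun _ => .quad
  | .quad =>
      peek .desc setBit <|
      branch (fun v => v.bit.isSome)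
        (load (fun v => { v with ok := true }) <| goto fun _ => .compare)
        (goto fun _ => .finish)
  | .compare =>
      pop .state setBit <|
      branch (fun v => v.bit.isSome)
        (push .aux (fun v => v.bit) <|
          load (fun v => { v with key := v.bit }) <|
          advance <|
          load (fun v => { v with ok := v.ok && v.bit == v.key }) <|
          goto fun _ => .compare)
        (goto fun _ => .action)
  | .action =>
      advance <|
      load (fun v => { v with ok := v.ok && v.bit == some v.sym.isSome }) <|
      advance <|
      load (fun v => { v with ok := v.ok && v.bit == some (v.sym.getD false) }) <|
      advance <|
      load (fun v => { v with act₀ := if v.ok then v.bit.getD false else v.act₀ }) <|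
      advance <|
      load (fun v => { v with act₁ := if v.ok then v.bit.getD false else v.act₁ }) <|
      advance <|
      load (fun v => { v with
        act₂ := if v.ok then v.bit.getD false else v.act₂
        found := v.found || v.ok }) <|
      goto fun _ => .copy
  | .copy =>
      pop .aux setBit <|
      branch (fun v => v.bit.isSome)
        (push .state (fun v => v.bit) <|
          advance <|
          branch (fun v => v.ok)
            (push .next (fun v => v.bit) <| goto fun _ => .copy)
            (goto fun _ => .copy))
        (goto fun _ => .quad)
  | .finish =>
      pop .back setBit <|
      branch (fun v => v.bit.isSome)
        (push .desc (fun v => v.bit) <| goto fun _ => .finish)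
        (branch (fun v => v.found) (goto fun _ => .apply) halt)
  | .apply =>
      branch (fun v => v.act₀)
        (pop .right setBit <|
          push .right (fun v => if v.act₁ then some v.act₂ else none) <|
          goto fun _ => .clear)
        (branch (fun v => v.act₁)
          (pop .right setBit <| push .left (fun v => v.bit) <| goto fun _ => .clear)
          (pop .left setBit <| push .right (fun v => v.bit) <| goto fun _ => .clear))
  | .clear =>
      pop .state setBit <|
      branch (fun v => v.bit.isSome)
        (goto fun _ => .clear)
        (goto fun _ => .install)
  | .install =>
      pop .next setBit <|
      branch (fun v => v.bit.isSome)
        (push .state (fun v => v.bit) <| goto fun _ => .install)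
        (goto fun _ => .fetch)

/-- The initial configuration on program `p` and input `y`. -/
def init (p y : List Bool) : TM2.Cfg (fun _ : Stack => Option Bool) Label Reg where
  l := some .parse
  var := Reg.init
  stk
    | .prog => p.map some
    | .right => y.map some
    | _ => []

/-- The output of the universal machine on program `p` and input `y` if it halts within
`t` of its own steps. -/
def run (t : ℕ) (p y : List Bool) : Option (List Bool) :=
  (haltsWithin (TM2.step program) t (init p y)).map fun c => readBits (c.stk .right)

end UTM

/-! ## Quantum circuits over the gate set `{H, T, CNOT}` -/

/-- A gate on `q` qubits. -/
inductive QGate (q : ℕ)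
  | H (i : Fin q)
  | T (i : Fin q)
  | CNOT (control target : Fin q) (ne : control ≠ target)

namespace QGate

variable {q : ℕ}

/-- The qubits on which a gate acts. -/
def wires : QGate q → Finset (Fin q)
  | H i => {i}
  | T i => {i}
  | CNOT i j _ => {i, j}

/-- The action of a gate on a vector of `(ℂ²)^{⊗q}`, given by its coordinates in the computational
basis. -/
noncomputable def apply : QGate q → ((Fin q → Bool) → ℂ) → (Fin q → Bool) → ℂ
  | H i, ψ, y =>
      (ψ (Function.update y i false) + (if y i then -1 else 1) * ψ (Function.update y i true)) /
        (√2 : ℝ)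
  | T i, ψ, y => (if y i then Complex.exp (Complex.I * (Real.pi / 4 : ℝ)) else 1) * ψ y
  | CNOT i j _, ψ, y => ψ (Function.update y j (xor (y i) (y j)))

theorem sum_flip (i : Fin q) (f : (Fin q → Bool) → ℝ) :
    ∑ y, f (Function.update y i (!y i)) = ∑ y, f y := by
  have h : Function.Involutive fun y : Fin q → Bool => Function.update y i (!y i) := by
    intro y
    simp
  exact Equiv.sum_comp h.toPerm f

theorem norm_sq_apply (g : QGate q) (ψ : (Fin q → Bool) → ℂ) :
    ∑ y, ‖g.apply ψ y‖ ^ 2 = ∑ y, ‖ψ y‖ ^ 2 := by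
  cases g with
  | H i =>
    have key : ∀ y : Fin q → Bool,
        ‖(H i).apply ψ y‖ ^ 2 + ‖(H i).apply ψ (Function.update y i (!y i))‖ ^ 2 =
          ‖ψ y‖ ^ 2 + ‖ψ (Function.update y i (!y i))‖ ^ 2 := by
      intro y
      have par : ∀ a b : ℂ, ‖(a + b) / ((√2 : ℝ) : ℂ)‖ ^ 2 + ‖(a + -b) / ((√2 : ℝ) : ℂ)‖ ^ 2 =
          ‖a‖ ^ 2 + ‖b‖ ^ 2 := by
        intro a b
        have h := parallelogram_law_with_norm ℝ a b
        rw [← sub_eq_add_neg, norm_div, norm_div, div_pow, div_pow]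
        simp only [Complex.norm_real, Real.norm_eq_abs, sq_abs]
        rw [Real.sq_sqrt (by norm_num)]
        nlinarith [h]
      cases hy : y i
      · have e : Function.update y i false = y := by rw [← hy]; simp
        have := par (ψ y) (ψ (Function.update y i true))
        simpa [apply, hy, e] using this
      · have e : Function.update y i true = y := by rw [← hy]; simp
        have := par (ψ (Function.update y i false)) (ψ y)
        simp only [apply, hy, e, Bool.not_true, Function.update_idem, Function.update_self]
        simp only [if_true, neg_one_mul, one_mul, Bool.false_eq_true, if_false]
        linarith
    have h1 := Finset.sum_congr (rfl : (Finset.univ : Finset (Fin q → Bool)) = _)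
      fun y _ => key y
    rw [Finset.sum_add_distrib, Finset.sum_add_distrib,
      sum_flip i fun y => ‖(H i).apply ψ y‖ ^ 2, sum_flip i fun y => ‖ψ y‖ ^ 2] at h1
    linarith
  | T i =>
    refine Finset.sum_congr rfl fun y _ => ?_
    have : ‖Complex.exp (Complex.I * (Real.pi / 4 : ℝ))‖ = 1 := by
      rw [mul_comm]
      exact Complex.norm_exp_ofReal_mul_I _
    by_cases hy : y i <;> simp only [apply, hy, if_true, norm_mul, this, one_mul,
      Bool.false_eq_true, if_false]
  | CNOT i j ne =>
    have h : Function.Involutive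
        fun y : Fin q → Bool => Function.update y j (xor (y i) (y j)) := by
      intro y
      simp [Function.update_of_ne ne]
    exact Equiv.sum_comp h.toPerm fun y => ‖ψ y‖ ^ 2

end QGate

/-- A quantum circuit: a sequence of layers of gates on `width` qubits, the gates of one layer acting
on pairwise disjoint sets of qubits. It starts in `|0…0⟩`, and in the end all qubits are measured in
the computational basis and the first `outputs` results are output. -/
@[ext]
structure QCircuit where
  width : ℕ
  outputs : ℕ
  layers : List (List (QGate width))
  outputs_le : outputs ≤ width
  disjoint : ∀ L ∈ layers, L.Pairwise fun g h => Disjoint g.wires h.wires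

namespace QCircuit

/-- The depth of a circuit. -/
def depth (C : QCircuit) : ℕ := C.layers.length

/-- The state before the measurement. -/
noncomputable def finalState (C : QCircuit) : (Fin C.width → Bool) → ℂ :=
  C.layers.flatten.foldl (fun ψ g => g.apply ψ) fun y => if y = fun _ => false then 1 else 0

theorem norm_finalState (C : QCircuit) : ∑ y, ENNReal.ofReal (‖C.finalState y‖ ^ 2) = 1 := by
  have h : ∀ (l : List (QGate C.width)) (ψ : (Fin C.width → Bool) → ℂ),
      ∑ y, ‖l.foldl (fun ψ g => g.apply ψ) ψ y‖ ^ 2 = ∑ y, ‖ψ y‖ ^ 2 := by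
    intro l
    induction l with
    | nil => intro ψ; rfl
    | cons g l ih => intro ψ; rw [List.foldl_cons, ih, QGate.norm_sq_apply]
  rw [← ENNReal.ofReal_sum_of_nonneg fun _ _ => by positivity, finalState, h,
    Finset.sum_eq_single fun _ => false]
  · simp
  · intro y _ hy
    simp [hy]
  · simp

/-- The distribution of the output of a circuit. -/
noncomputable def sample (C : QCircuit) : PMF (List Bool) :=
  (PMF.ofFintype (fun y => ENNReal.ofReal (‖C.finalState y‖ ^ 2)) C.norm_finalState).map
    fun y => List.ofFn fun i : Fin C.outputs => y (Fin.castLE C.outputs_le i)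

end QCircuit

/-! ### Circuits as bit strings -/

/-- A code none of whose words is a prefix of another one, and which is injective. -/
def PrefixCode {α : Type*} (e : α → List Bool) : Prop :=
  ∀ a b r s, e a ++ r = e b ++ s → a = b ∧ r = s

/-- A number in unary. -/
def encodeUnary (n : ℕ) : List Bool := List.replicate n true ++ [false]

/-- A list, each entry announced by a `1`, and terminated by a `0`. -/
def encodeList {α : Type*} (e : α → List Bool) : List α → List Bool
  | [] => [false]
  | a :: l => true :: (e a ++ encodeList e l)

/-- A number in self-delimiting binary. -/
def encodeBinary (n : ℕ) : List Bool := encodeList (fun b => [b]) n.bits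

/-- A gate: its type and its qubits. -/
def QGate.encode {q : ℕ} : QGate q → List Bool
  | .H i => false :: false :: encodeBinary i
  | .T i => false :: true :: encodeBinary i
  | .CNOT i j _ => true :: (encodeBinary i ++ encodeBinary j)

/-- The numbers of qubits and of outputs in unary, and the list of layers. -/
def QCircuit.encode (C : QCircuit) : List Bool :=
  encodeUnary C.width ++ encodeUnary C.outputs ++ encodeList (encodeList QGate.encode) C.layers

theorem prefixCode_unary : PrefixCode encodeUnary := by
  intro a
  induction a with
  | zero => intro b r s h; cases b <;> simp_all [encodeUnary, List.replicate_succ]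
  | succ a ih =>
    intro b r s h
    cases b with
    | zero => simp [encodeUnary, List.replicate_succ] at h
    | succ b =>
      have := ih b r s (by simpa [encodeUnary, List.replicate_succ] using h)
      exact ⟨by rw [this.1], this.2⟩

theorem PrefixCode.list {α : Type*} {e : α → List Bool} (he : PrefixCode e) :
    PrefixCode (encodeList e) := by
  intro a
  induction a with
  | nil => intro b r s h; cases b <;> simp_all [encodeList]
  | cons x l ih =>
    intro b r s h
    cases b with
    | nil => simp [encodeList] at h
    | cons y m =>
      simp only [encodeList, List.cons_append, List.append_assoc, List.cons.injEq, true_and] at h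
      obtain ⟨h1, h2⟩ := he _ _ _ _ h
      obtain ⟨h3, h4⟩ := ih _ _ _ h2
      exact ⟨by rw [h1, h3], h4⟩

theorem prefixCode_binary : PrefixCode encodeBinary := by
  intro a b r s h
  have hb : PrefixCode fun b : Bool => [b] := by
    intro a b r s h
    simpa using h
  obtain ⟨h1, h2⟩ := hb.list _ _ _ _ h
  refine ⟨?_, h2⟩
  rw [← Nat.digits_inj_iff (b := 2), Nat.digits_two_eq_bits, Nat.digits_two_eq_bits, h1]

theorem prefixCode_gate {q : ℕ} : PrefixCode (QGate.encode (q := q)) := by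
  intro a b r s h
  cases a <;> cases b <;> simp only [QGate.encode, List.cons_append, List.append_assoc,
    List.cons.injEq, true_and, false_and, Bool.false_eq_true, Bool.true_eq_false] at h
  · obtain ⟨h1, h2⟩ := prefixCode_binary _ _ _ _ h
    exact ⟨by rw [Fin.ext h1], h2⟩
  · obtain ⟨h1, h2⟩ := prefixCode_binary _ _ _ _ h
    exact ⟨by rw [Fin.ext h1], h2⟩
  · obtain ⟨h1, h2⟩ := prefixCode_binary _ _ _ _ h
    obtain ⟨h3, h4⟩ := prefixCode_binary _ _ _ _ h2
    obtain rfl := Fin.ext h1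
    obtain rfl := Fin.ext h3
    exact ⟨rfl, h4⟩

theorem QCircuit.encode_injective : Function.Injective QCircuit.encode := by
  rintro ⟨w, o, l, h1, h2⟩ ⟨w', o', l', h1', h2'⟩ h
  simp only [QCircuit.encode, List.append_assoc] at h
  obtain ⟨h3, h⟩ := prefixCode_unary _ _ _ _ h
  obtain rfl : w = w' := h3
  obtain ⟨h4, h⟩ := prefixCode_unary _ _ _ _ h
  obtain rfl : o = o' := h4
  obtain ⟨h5, -⟩ := (prefixCode_gate.list).list l l' [] [] (by simpa using h)
  subst h5
  rfl

/-- The quantum algorithm `QU^t`: sample from the circuit of depth at most `t` that `c` encodes;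
the output is `⊥`, here `none`, if `c` does not encode such a circuit. (Since the encoding is
injective, `Function.partialInv` is decoding.) -/
noncomputable def QU (t : ℕ) (c : List Bool) : PMF (Option (List Bool)) :=
  match Function.partialInv QCircuit.encode c with
  | some C => if C.depth ≤ t then C.sample.map some else PMF.pure none
  | none => PMF.pure none

/-- `QU^t` applied to the outcome of a classical computation that may not have halted in time. -/
noncomputable def QU' (t : ℕ) : Option (List Bool) → PMF (Option (List Bool))
  | some c => QU t c
  | none => PMF.pure none

/-! ## Quantum algorithms and `quK` -/

/-- A `t(n)`-time quantum algorithm: a classical Turing machine that, on every input `1^n`, halts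
within `t n` steps; its output is then handed to `QU^{t n}`. -/
structure QuantumAlgorithm (t : ℕ → ℕ) where
  /-- the number of non-initial states of the machine -/
  k : ℕ
  machine : BinTM k
  halts : ∀ n, (machine.run (t n) (List.replicate n true)).isSome

namespace QuantumAlgorithm

variable {t : ℕ → ℕ}

/-- The distribution of the output on input `1^n`. -/
noncomputable def sample (D : QuantumAlgorithm t) (n : ℕ) : PMF (Option (List Bool)) :=
  QU' (t n) (D.machine.run (t n) (List.replicate n true))

/-- The description length. -/
def size (D : QuantumAlgorithm t) : ℕ := D.machine.encode.length

end QuantumAlgorithm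

/-- The universal quantum sampler `Q^t(1^n)`: draw a uniformly random program of `t` bits, run the
universal machine on it and on `1^n` for `t` steps, and apply `QU^t` to the result. -/
noncomputable def universalSampler (t n : ℕ) : PMF (Option (List Bool)) :=
  (PMF.uniformOfFintype (Fin t → Bool)).bind fun p =>
    QU' t (UTM.run t (List.ofFn p) (List.replicate n true))

/-- The logarithm to base `2`, with `log₂ 0 = -∞` and `log₂ ∞ = ∞`. -/
noncomputable def log₂ (p : ℝ≥0∞) : EReal := ENNReal.log p / (Real.log 2 : ℝ)

/-- `quK^t(x | 1^n)`. -/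
noncomputable def quK (t : ℕ) (x : List Bool) (n : ℕ) : EReal :=
  -log₂ (universalSampler t n (some x))

/-! ## Runs with a bound on the number of steps -/

section Runs

variable {C : Type*} {step : C → Option C}

/-! Fix `n`, and let `M` be the classical machine of the algorithm, with circuit code `out` on
`1^n`. A uniformly random program of `T` bits starts with the self-delimiting form of `⟨M⟩` with
probability `2^-(2|⟨M⟩|+1)`. Every such program makes the universal machine output `out`, provided
that `T` steps are enough. Raising the depth bound from `t(n)` to `T` does not lower the probability
of any string. Hence `x` is sampled with probability at least `2^-(2|⟨M⟩|+1)` times its probability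
under the algorithm; taking `-log₂` gives the bound with `c = 1`.

The difficulty is that `T` depends on `t(n)` only, while `⟨M⟩` may be far longer than `T`.
`exists_small` removes it: a run of at most `t` steps visits at most `t + 1` states, and restricting
`M` to these, renumbered, preserves this run without lengthening the description. The new machine
may depend on `n`, since `n` is fixed. Its description has polynomial length in `t`, and each of its
steps costs the universal machine one pass through the description, so `run_selfDelim` needs only
polynomially many steps. The input is already on a stack, so its length does not enter the time.

Times are tracked as upper bounds through `ReachesWithin`, which speaks only of the eventual halting
configuration and therefore composes and weakens freely. -/

theorem haltsWithin_of_none {c : C} (h : step c = none) (t : ℕ) :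
    haltsWithin step t c = some c := by
  cases t <;> simp [haltsWithin, h]

theorem haltsWithin_succ_of_some {c c' : C} (h : step c = some c') (t : ℕ) :
    haltsWithin step (t + 1) c = haltsWithin step t c' := by
  simp [haltsWithin, h]

theorem haltsWithin_mono {t t' : ℕ} (h : t ≤ t') {c d : C} (hc : haltsWithin step t c = some d) :
    haltsWithin step t' c = some d := by
  induction t generalizing t' c with
  | zero =>
    cases hs : step c with
    | none => simpa [haltsWithin, hs, haltsWithin_of_none hs] using hc
    | some c' => simp [haltsWithin, hs] at hc
  | succ t ih =>
    obtain ⟨t', rfl⟩ := Nat.exists_eq_add_of_lt h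
    cases hs : step c with
    | none => simpa [haltsWithin, hs, haltsWithin_of_none hs] using hc
    | some c' =>
      rw [haltsWithin_succ_of_some hs] at hc ⊢
      exact ih (by omega) hc

/-- `c` leads to `c'` in at most `N` steps, as far as halting computations are concerned. -/
def ReachesWithin (step : C → Option C) (N : ℕ) (c c' : C) : Prop :=
  ∀ t d, haltsWithin step t c' = some d → haltsWithin step (t + N) c = some d

namespace ReachesWithin

variable {c c' c'' : C} {N N' : ℕ}

theorem refl (c : C) : ReachesWithin step 0 c c := fun _ _ h => h

theorem single (h : step c = some c') : ReachesWithin step 1 c c' := fun t _ hd => by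
  rw [haltsWithin_succ_of_some h, hd]

theorem trans (h : ReachesWithin step N c c') (h' : ReachesWithin step N' c' c'') :
    ReachesWithin step (N + N') c c'' := fun t d hd => by
  have := h _ _ (h' t d hd)
  rwa [show t + (N + N') = t + N' + N by omega]

theorem mono (h : ReachesWithin step N c c') (hN : N ≤ N') : ReachesWithin step N' c c' :=
  fun t d hd => haltsWithin_mono (by omega) (h t d hd)

theorem head (h : step c = some c') (h' : ReachesWithin step N c' c'') :
    ReachesWithin step (N + 1) c c'' :=
  ((single h).trans h').mono (by omega)

theorem trans_eq {c₁ c₂ : C} (h : ReachesWithin step N c c₁) (h' : ReachesWithin step N' c₂ c'')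
    (e : c₁ = c₂) : ReachesWithin step (N + N') c c'' :=
  h.trans (e ▸ h')

theorem of_eq {d d' : C} (h : ReachesWithin step N c c') (hc : d = c) (hd : c' = d')
    (hN : N ≤ N') : ReachesWithin step N' d d' :=
  hc ▸ hd ▸ h.mono hN

end ReachesWithin

end Runs

/-! ## The single loops of the universal machine -/

namespace UTM

/-- The contents of the eight stacks. -/
def stackFn (p d b s a n l r : List (Option Bool)) : Stack → List (Option Bool)
  | .prog => p
  | .desc => d
  | .back => b
  | .state => s
  | .aux => a
  | .next => n
  | .left => l
  | .right => r

/-! ### Stack contents as an eight-tuple, for evaluating single steps. -/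

section update

variable (p d b s a n l r x : List (Option Bool))

@[simp] theorem update_prog :
    Function.update (stackFn p d b s a n l r) .prog x = stackFn x d b s a n l r := by
  funext k; cases k <;> rfl

@[simp] theorem update_desc :
    Function.update (stackFn p d b s a n l r) .desc x = stackFn p x b s a n l r := by
  funext k; cases k <;> rfl

@[simp] theorem update_back :
    Function.update (stackFn p d b s a n l r) .back x = stackFn p d x s a n l r := by
  funext k; cases k <;> rfl

@[simp] theorem update_state :
    Function.update (stackFn p d b s a n l r) .state x = stackFn p d b x a n l r := by
  funext k; cases k <;> rfl

@[simp] theorem update_aux :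
    Function.update (stackFn p d b s a n l r) .aux x = stackFn p d b s x n l r := by
  funext k; cases k <;> rfl

@[simp] theorem update_next :
    Function.update (stackFn p d b s a n l r) .next x = stackFn p d b s a x l r := by
  funext k; cases k <;> rfl

@[simp] theorem update_left :
    Function.update (stackFn p d b s a n l r) .left x = stackFn p d b s a n x r := by
  funext k; cases k <;> rfl

@[simp] theorem update_right :
    Function.update (stackFn p d b s a n l r) .right x = stackFn p d b s a n l x := by
  funext k; cases k <;> rfl

@[simp] theorem stackFn_prog : stackFn p d b s a n l r .prog = p := rfl
@[simp] theorem stackFn_desc : stackFn p d b s a n l r .desc = d := rfl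
@[simp] theorem stackFn_back : stackFn p d b s a n l r .back = b := rfl
@[simp] theorem stackFn_state : stackFn p d b s a n l r .state = s := rfl
@[simp] theorem stackFn_aux : stackFn p d b s a n l r .aux = a := rfl
@[simp] theorem stackFn_next : stackFn p d b s a n l r .next = n := rfl
@[simp] theorem stackFn_left : stackFn p d b s a n l r .left = l := rfl
@[simp] theorem stackFn_right : stackFn p d b s a n l r .right = r := rfl

end update

/-- A configuration of the universal machine at a label. -/
abbrev cfg (q : Label) (v : Reg) (p d b s a n l r : List (Option Bool)) :
    TM2.Cfg (fun _ : Stack => Option Bool) Label Reg :=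
  ⟨some q, v, stackFn p d b s a n l r⟩

/-- The self-delimiting form of a bit string. -/
def selfDelim (l : List Bool) : List Bool := l.flatMap (fun b => [true, b]) ++ [false]

variable {v : Reg} {p d b s a n l r : List (Option Bool)}

/-- The final register bit and the unread program are left existential: nothing later depends on
them, which is why the bits after the self-delimiting prefix are irrelevant. -/
theorem parse_reaches (u rest : List Bool) : ∃ o p',
    ReachesWithin (TM2.step program) (u.length + 1)
      (cfg .parse v ((selfDelim u ++ rest).map some) d b s a n l r)
      (cfg .rewind { v with bit := o } p' d (u.reverse.map some ++ b) s a n l r) := by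
  induction u generalizing v b with
  | nil => exact ⟨some false, rest.map some, .single (by simp [program, selfDelim, setBit])⟩
  | cons x u ih =>
    obtain ⟨o, p', h⟩ := ih (v := { v with bit := some x }) (b := some x :: b)
    refine ⟨o, p', .head (c' := cfg .parse { v with bit := some x }
      ((selfDelim u ++ rest).map some) d (some x :: b) s a n l r) ?_ ?_⟩
    · simp [program, selfDelim, setBit]
    · simpa using h

theorem rewind_reaches (u : List Bool) :
    ReachesWithin (TM2.step program) (u.length + 1)
      (cfg .rewind v p d (u.map some) s a n l r)
      (cfg .header { v with bit := none } p (u.reverse.map some ++ d) [] s a n l r) := by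
  induction u generalizing v d with
  | nil => exact .single (by simp [program, setBit])
  | cons x u ih =>
    refine .head (c' := cfg .rewind { v with bit := some x } p (some x :: d) (u.map some)
      s a n l r) ?_ ?_
    · simp [program, setBit]
    · simpa using ih (v := { v with bit := some x }) (d := some x :: d)

theorem header_reaches (w : ℕ) :
    ReachesWithin (TM2.step program) (w + 1)
      (cfg .header v p ((List.replicate w true).map some ++ some false :: d) b s a n l r)
      (cfg .fetch { v with bit := some false } p d b
        ((List.replicate w false).map some ++ s) a n l r) := by
  induction w generalizing v s with
  | zero => exact .single (by simp [program, setBit])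
  | succ w ih =>
    refine .head (c' := cfg .header { v with bit := some true } p
      ((List.replicate w true).map some ++ some false :: d) b (some false :: s) a n l r) ?_ ?_
    · simp [program, setBit, List.replicate_succ]
    · have e : (List.replicate (w + 1) false).map some ++ s =
          (List.replicate w false).map some ++ some false :: s := by
        simp [List.replicate_succ']
      rw [e]
      exact ih

/-- A mismatch only clears `ok`; the loop still runs through the whole name, so the time and the
resulting stacks do not depend on the outcome. -/
theorem compare_reaches (u u' : List Bool) (h : u.length = u'.length) : ∃ key,
    ReachesWithin (TM2.step program) (u.length + 1)
      (cfg .compare v p (u'.map some ++ d) b (u.map some) a n l r)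
      (cfg .action { v with bit := none, key := key, ok := v.ok && decide (u' = u) } p d
        (u'.reverse.map some ++ b) [] (u.reverse.map some ++ a) n l r) := by
  induction u generalizing v b a u' with
  | nil =>
    obtain rfl : u' = [] := List.length_eq_zero_iff.1 h.symm
    exact ⟨v.key, .single (by simp [program, setBit])⟩
  | cons x u ih =>
    obtain _ | ⟨x', u'⟩ := u'
    · simp at h
    obtain ⟨key, H⟩ := ih (v := { v with bit := some x', key := some x, ok := v.ok && x' == x })
      (b := some x' :: b) (a := some x :: a) u' (by simpa using h)
    refine ⟨key, .head (c' := cfg .compare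
      { v with bit := some x', key := some x, ok := v.ok && x' == x } p (u'.map some ++ d)
      (some x' :: b) (u.map some) (some x :: a) n l r) ?_ ?_⟩
    · simp [program, setBit, advance]
    · have e : (v.ok && decide (x' :: u' = x :: u)) = (v.ok && x' == x && decide (u' = u)) := by
        rw [Bool.eq_iff_iff]
        simp [and_assoc]
      rw [e]
      simpa using H

/-- One step suffices because `TM2.step` executes everything up to the next `goto`. The two bits of
a symbol `t` are `t.isSome` and `t.getD false`, exactly those the program tests. -/
theorem action_reaches (t : Option Bool) (x y z : Bool) : ∃ o,
    ReachesWithin (TM2.step program) 1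
      (cfg .action v p ((BinTM.encodeSymbol t ++ [x, y, z]).map some ++ d) b s a n l r)
      (cfg .copy
        { v with
          bit := o
          ok := v.ok && decide (t = v.sym)
          found := v.found || (v.ok && decide (t = v.sym))
          act₀ := if v.ok && decide (t = v.sym) then x else v.act₀
          act₁ := if v.ok && decide (t = v.sym) then y else v.act₁
          act₂ := if v.ok && decide (t = v.sym) then z else v.act₂ } p d
        ((BinTM.encodeSymbol t ++ [x, y, z]).reverse.map some ++ b) s a n l r) := by
  refine ⟨some z, .single ?_⟩
  obtain ⟨o, key, sym, ok, found, a0, a1, a2⟩ := v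
  rcases t with _ | _ | _ <;> rcases sym with _ | _ | _ <;> cases ok <;>
    simp [program, setBit, advance, BinTM.encodeSymbol]

/-- The second reversal, from `aux` back to `state`, restores the current name. The new name ends up
reversed on `next`; `install` reverses it again. -/
theorem copy_reaches (u u' : List Bool) (h : u.length = u'.length) :
    ReachesWithin (TM2.step program) (u.length + 1)
      (cfg .copy v p (u'.map some ++ d) b s (u.map some) n l r)
      (cfg .quad { v with bit := none } p d (u'.reverse.map some ++ b)
        (u.reverse.map some ++ s) [] (if v.ok then u'.reverse.map some ++ n else n) l r) := by
  induction u generalizing v b s n u' with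
  | nil =>
    obtain rfl : u' = [] := List.length_eq_zero_iff.1 h.symm
    exact .single (by simp [program, setBit])
  | cons x u ih =>
    obtain _ | ⟨x', u'⟩ := u'
    · simp at h
    have H := ih (v := { v with bit := some x' }) (b := some x' :: b) (s := some x :: s)
      (n := if v.ok then some x' :: n else n) u' (by simpa using h)
    refine .head (c' := cfg .copy { v with bit := some x' } p (u'.map some ++ d)
      (some x' :: b) (some x :: s) (u.map some) (if v.ok then some x' :: n else n) l r) ?_ ?_
    · cases hv : v.ok <;> simp [program, setBit, advance, hv]
    · cases hv : v.ok <;> simpa [hv] using H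

/-- The final step, which finds `back` empty, is left out because it branches on `found`. -/
theorem finish_reaches (u : List Bool) :
    ReachesWithin (TM2.step program) u.length
      (cfg .finish v p d (u.map some) s a n l r)
      (cfg .finish { v with bit := u.getLast?.or v.bit } p (u.reverse.map some ++ d) []
        s a n l r) := by
  induction u generalizing v d with
  | nil => exact .refl _
  | cons x u ih =>
    refine .head (c' := cfg .finish { v with bit := some x } p (some x :: d) (u.map some)
      s a n l r) ?_ ?_
    · simp [program, setBit]
    · convert ih (v := { v with bit := some x }) (d := some x :: d) using 2
      · cases h : u.getLast? <;> simp [List.getLast?_cons, h]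
      · simp

theorem clear_reaches (u : List Bool) :
    ReachesWithin (TM2.step program) (u.length + 1)
      (cfg .clear v p d b (u.map some) a n l r)
      (cfg .install { v with bit := none } p d b [] a n l r) := by
  induction u generalizing v with
  | nil => exact .single (by simp [program, setBit])
  | cons x u ih =>
    refine .head (c' := cfg .clear { v with bit := some x } p d b (u.map some) a n l r) ?_ ?_
    · simp [program, setBit]
    · simpa using ih (v := { v with bit := some x })

theorem install_reaches (u : List Bool) :
    ReachesWithin (TM2.step program) (u.length + 1)
      (cfg .install v p d b s a (u.map some) l r)
      (cfg .fetch { v with bit := none } p d b (u.reverse.map some ++ s) a [] l r) := by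
  induction u generalizing v s with
  | nil => exact .single (by simp [program, setBit])
  | cons x u ih =>
    refine .head (c' := cfg .install { v with bit := some x } p d b (some x :: s) a
      (u.map some) l r) ?_ ?_
    · simp [program, setBit]
    · simpa using ih (v := { v with bit := some x }) (s := some x :: s)

end UTM

/-! ## Simulating one step -/

/-! ### Layout and length of the list of quadruples. -/

namespace BinTM

variable {k : ℕ}

/-- The description of the quadruple for a state and a scanned symbol, if there is one. -/
def quadBits (M : BinTM k) (w : ℕ) (x : Fin (k + 1) × Option Bool) : List Bool :=
  match M x.1 x.2 with
  | none => []
  | some (q', a) => encodeState w x.1 ++ encodeSymbol x.2 ++ encodeAction a ++ encodeState w q'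

/-- All pairs of a state and a symbol. -/
def keys (k : ℕ) : List (Fin (k + 1) × Option Bool) :=
  List.finRange (k + 1) ×ˢ [none, some false, some true]

/-- The list of quadruples in the description of a machine. -/
def body (M : BinTM k) : List Bool := (keys k).flatMap (quadBits M (Nat.size k))

theorem encode_eq (M : BinTM k) :
    M.encode = List.replicate (Nat.size k) true ++ false :: M.body := by
  simp only [encode, body, keys, SProd.sprod, List.product, List.flatMap_assoc, List.flatMap_map]
  rfl

theorem mem_keys (x : Fin (k + 1) × Option Bool) : x ∈ keys k := by
  obtain ⟨q, _ | _ | _⟩ := x <;> simp [keys]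

theorem nodup_keys : (keys k).Nodup :=
  (List.nodup_finRange _).product (by decide)

theorem length_keys : (keys k).length = 3 * (k + 1) := by
  simp [keys, List.length_product, mul_comm]

@[simp] theorem length_encodeState (w q : ℕ) : (encodeState w q).length = w := by
  simp [encodeState]

@[simp] theorem length_encodeSymbol (s : Option Bool) : (encodeSymbol s).length = 2 := by
  cases s <;> rfl

theorem length_encodeAction (a : TM0.Stmt (Option Bool)) : (encodeAction a).length = 3 := by
  obtain (_ | _) | s := a <;> simp [encodeAction]

/-- States are at most `k < 2 ^ Nat.size k`, so all bits beyond the encoded ones vanish. -/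
theorem encodeState_injective {q q' : Fin (k + 1)}
    (h : encodeState (Nat.size k) q = encodeState (Nat.size k) q') : q = q' := by
  have hlt (q : Fin (k + 1)) : (q : ℕ) < 2 ^ Nat.size k :=
    (Nat.le_of_lt_succ q.2).trans_lt (Nat.lt_size_self k)
  refine Fin.ext (Nat.eq_of_testBit_eq fun i => ?_)
  by_cases hi : i < Nat.size k
  · have := congrArg (fun l => l[i]?) h
    simpa [encodeState, hi] using this
  · have hp : 2 ^ Nat.size k ≤ 2 ^ i := Nat.pow_le_pow_right (by norm_num) (by omega)
    rw [Nat.testBit_lt_two_pow ((hlt q).trans_le hp), Nat.testBit_lt_two_pow ((hlt q').trans_le hp)]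

theorem length_quadBits_le (M : BinTM k) (w : ℕ) (x : Fin (k + 1) × Option Bool) :
    (quadBits M w x).length ≤ 2 * w + 5 := by
  unfold quadBits
  split <;> simp [length_encodeAction]
  omega

theorem length_body_le (M : BinTM k) :
    M.body.length ≤ 3 * (k + 1) * (2 * Nat.size k + 5) := by
  rw [body, List.length_flatMap, ← length_keys, ← smul_eq_mul]
  refine (List.sum_le_card_nsmul _ (2 * Nat.size k + 5) ?_).trans_eq (by simp)
  simp only [List.mem_map]
  rintro _ ⟨x, -, rfl⟩
  exact length_quadBits_le M _ x

end BinTM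

/-! ### One pass through the description. -/

namespace UTM

open BinTM

variable {p d b n l r : List (Option Bool)} {k : ℕ}

/-- One round `quad`, `compare`, `action`, `copy`, costing `1 + (|s| + 1) + 1 + (|s| + 1)` steps.
The quadruple is moved to `back` and the state name is restored, so that rounds can be chained. -/
theorem quad_reaches (v : Reg) (u s u' : List Bool) (hu : u.length = s.length)
    (hu' : u'.length = s.length) (t : Option Bool) (x y z : Bool) : ∃ v' : Reg,
    v'.sym = v.sym ∧ v'.found = (v.found || decide (u = s) && decide (t = v.sym)) ∧
    v'.act₀ = (if decide (u = s) && decide (t = v.sym) then x else v.act₀) ∧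
    v'.act₁ = (if decide (u = s) && decide (t = v.sym) then y else v.act₁) ∧
    v'.act₂ = (if decide (u = s) && decide (t = v.sym) then z else v.act₂) ∧
    ReachesWithin (TM2.step program) (2 * s.length + 4)
      (cfg .quad v p ((u ++ encodeSymbol t ++ [x, y, z] ++ u').map some ++ d) b (s.map some) [] n l r)
      (cfg .quad v' p d ((u ++ encodeSymbol t ++ [x, y, z] ++ u').reverse.map some ++ b)
        (s.map some) [] (if decide (u = s) && decide (t = v.sym) then u'.reverse.map some ++ n else n)
        l r) := by
  obtain ⟨c, cs, hc⟩ : ∃ c cs, u ++ encodeSymbol t ++ [x, y, z] ++ u' = c :: cs :=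
    List.exists_cons_of_ne_nil (by simp)
  have h1 : ReachesWithin (TM2.step program) 1
      (cfg .quad v p ((u ++ encodeSymbol t ++ [x, y, z] ++ u').map some ++ d) b (s.map some) [] n l r)
      (cfg .compare { v with bit := some c, ok := true } p
        ((u ++ encodeSymbol t ++ [x, y, z] ++ u').map some ++ d) b (s.map some) [] n l r) := by
    rw [hc]
    exact .single (by simp [program, setBit])
  obtain ⟨key, h2⟩ := compare_reaches (v := { v with bit := some c, ok := true }) (p := p)
    (d := (encodeSymbol t ++ [x, y, z] ++ u').map some ++ d) (b := b) (a := []) (n := n) (l := l)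
    (r := r) s u hu.symm
  obtain ⟨o, h3⟩ := action_reaches
    (v := { v with bit := none, key := key, ok := true && decide (u = s) }) (p := p)
    (d := u'.map some ++ d) (b := u.reverse.map some ++ b) (s := [])
    (a := s.reverse.map some) (n := n) (l := l) (r := r) t x y z
  have h4 := copy_reaches
    (v := { v with
      bit := o
      key := key
      ok := decide (u = s) && decide (t = v.sym)
      found := v.found || (decide (u = s) && decide (t = v.sym))
      act₀ := if decide (u = s) && decide (t = v.sym) then x else v.act₀
      act₁ := if decide (u = s) && decide (t = v.sym) then y else v.act₁
      act₂ := if decide (u = s) && decide (t = v.sym) then z else v.act₂ }) (p := p)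
    (d := d) (b := (u ++ encodeSymbol t ++ [x, y, z]).reverse.map some ++ b) (s := [])
    (n := n) (l := l) (r := r) s.reverse u' (by simp [hu'])
  refine ⟨_, ?_, ?_, ?_, ?_, ?_, (((h1.trans_eq h2 (by simp)).trans_eq h3 (by simp)).trans_eq h4
    (by simp)).of_eq rfl (by simp; rfl) (by simp; omega)⟩
  all_goals simp

/-- Two registers agree on what they record of the current pass. -/
structure Reg.Agree (v v' : Reg) : Prop where
  sym : v'.sym = v.sym
  found : v'.found = v.found
  act₀ : v'.act₀ = v.act₀
  act₁ : v'.act₁ = v.act₁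
  act₂ : v'.act₂ = v.act₂

theorem Reg.Agree.trans {v v' v'' : Reg} (h : v.Agree v') (h' : v'.Agree v'') : v.Agree v'' :=
  ⟨h'.1.trans h.1, h'.2.trans h.2, h'.3.trans h.3, h'.4.trans h.4, h'.5.trans h.5⟩

/-- The three bits that describe an action. -/
theorem exists_encodeAction (a : TM0.Stmt (Option Bool)) : ∃ x y z, encodeAction a = [x, y, z] := by
  obtain (_ | _) | _ | _ := a <;> exact ⟨_, _, _, rfl⟩

/-- The registers hold an action. -/
def Reg.Holds (v : Reg) (a : TM0.Stmt (Option Bool)) : Prop :=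
  encodeAction a = [v.act₀, v.act₁, v.act₂]

theorem Reg.Holds.of_agree {v v' : Reg} {a} (h : v.Holds a) (hv : v.Agree v') : v'.Holds a := by
  rw [Holds, hv.act₀, hv.act₁, hv.act₂]
  exact h

variable (M : BinTM k) (q : Fin (k + 1))

/-- The hypothesis covers both reasons for skipping: the key has no quadruple, so its block is
empty, or the key differs from the current one, so some comparison fails. -/
theorem key_skip (v : Reg) (x : Fin (k + 1) × Option Bool)
    (hx : M x.1 x.2 ≠ none → x ≠ (q, v.sym)) : ∃ v', v.Agree v' ∧
    ReachesWithin (TM2.step program) (2 * Nat.size k + 4)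
      (cfg .quad v p ((quadBits M (Nat.size k) x).map some ++ d) b
        ((encodeState (Nat.size k) q).map some) [] n l r)
      (cfg .quad v' p d ((quadBits M (Nat.size k) x).reverse.map some ++ b)
        ((encodeState (Nat.size k) q).map some) [] n l r) := by
  cases hM : M x.1 x.2 with
  | none =>
    refine ⟨v, ⟨rfl, rfl, rfl, rfl, rfl⟩, ?_⟩
    simpa [quadBits, hM] using (ReachesWithin.refl _).mono (Nat.zero_le _)
  | some y =>
    obtain ⟨q', a⟩ := y
    obtain ⟨x0, y0, z0, ha⟩ := exists_encodeAction a
    have hne : (decide (encodeState (Nat.size k) x.1 = encodeState (Nat.size k) q) &&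
        decide (x.2 = v.sym)) = false := by
      rw [Bool.eq_false_iff]
      simp only [ne_eq, Bool.and_eq_true, decide_eq_true_eq, not_and]
      intro h1 h2
      exact hx (by simp [hM]) (Prod.ext (encodeState_injective h1) h2)
    obtain ⟨v', h1, h2, h3, h4, h5, h6⟩ := quad_reaches (p := p) (d := d) (b := b) (n := n) (l := l)
      (r := r) v (encodeState (Nat.size k) x.1) (encodeState (Nat.size k) q)
      (encodeState (Nat.size k) q') (by simp) (by simp) x.2 x0 y0 z0
    simp only [hne, Bool.or_false, Bool.false_eq_true, if_false] at h2 h3 h4 h5 h6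
    refine ⟨v', ⟨h1, h2, h3, h4, h5⟩, ?_⟩
    simpa only [quadBits, hM, ha, length_encodeState] using h6

theorem key_hit (v : Reg) {q' : Fin (k + 1)} {a} (hM : M q v.sym = some (q', a)) : ∃ v',
    v'.Holds a ∧ v'.sym = v.sym ∧ v'.found = true ∧
    ReachesWithin (TM2.step program) (2 * Nat.size k + 4)
      (cfg .quad v p ((quadBits M (Nat.size k) (q, v.sym)).map some ++ d) b
        ((encodeState (Nat.size k) q).map some) [] n l r)
      (cfg .quad v' p d ((quadBits M (Nat.size k) (q, v.sym)).reverse.map some ++ b)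
        ((encodeState (Nat.size k) q).map some) []
        ((encodeState (Nat.size k) q').reverse.map some ++ n) l r) := by
  obtain ⟨x0, y0, z0, ha⟩ := exists_encodeAction a
  obtain ⟨v', h1, h2, h3, h4, h5, h6⟩ := quad_reaches (p := p) (d := d) (b := b) (n := n) (l := l)
    (r := r) v (encodeState (Nat.size k) q) (encodeState (Nat.size k) q)
    (encodeState (Nat.size k) q') (by simp) (by simp) v.sym x0 y0 z0
  simp only [decide_true, Bool.and_true, Bool.or_true, if_true] at h2 h3 h4 h5 h6
  refine ⟨v', by rw [Reg.Holds, h3, h4, h5, ha], h1, h2, ?_⟩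
  simpa only [quadBits, hM, ha, length_encodeState] using h6

theorem keys_skip (v : Reg) (L : List (Fin (k + 1) × Option Bool))
    (hL : ∀ x ∈ L, M x.1 x.2 ≠ none → x ≠ (q, v.sym)) : ∃ v', v.Agree v' ∧
    ReachesWithin (TM2.step program) (L.length * (2 * Nat.size k + 4))
      (cfg .quad v p ((L.flatMap (quadBits M (Nat.size k))).map some ++ d) b
        ((encodeState (Nat.size k) q).map some) [] n l r)
      (cfg .quad v' p d ((L.flatMap (quadBits M (Nat.size k))).reverse.map some ++ b)
        ((encodeState (Nat.size k) q).map some) [] n l r) := by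
  induction L generalizing v b with
  | nil => exact ⟨v, ⟨rfl, rfl, rfl, rfl, rfl⟩, (ReachesWithin.refl _).mono (Nat.zero_le _)⟩
  | cons x L ih =>
    obtain ⟨v1, hv1, h1⟩ := key_skip (p := p) (b := b) (n := n) (l := l) (r := r)
      (d := (L.flatMap (quadBits M (Nat.size k))).map some ++ d) M q v x (hL x (by simp))
    obtain ⟨v2, hv2, h2⟩ := ih (b := (quadBits M (Nat.size k) x).reverse.map some ++ b) v1
      (by rw [hv1.sym]; exact fun y hy => hL y (by simp [hy]))
    refine ⟨v2, hv1.trans hv2, (h1.trans h2).of_eq (by simp) (by simp) ?_⟩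
    rw [List.length_cons]; linarith

/-- The number of steps for one pass through the description. -/
def passTime (k : ℕ) : ℕ :=
  3 * (k + 1) * (2 * Nat.size k + 4) + 3 * (k + 1) * (2 * Nat.size k + 5) + 2

theorem quad_finish (v : Reg) {a s : List (Option Bool)} (u : List Bool) : ∃ v', v.Agree v' ∧
    ReachesWithin (TM2.step program) (u.length + 1)
      (cfg .quad v p [] (u.reverse.map some) s a n l r)
      (cfg .finish v' p (u.map some) [] s a n l r) := by
  have h1 : ReachesWithin (TM2.step program) 1
      (cfg .quad v p [] (u.reverse.map some) s a n l r)
      (cfg .finish { v with bit := none } p [] (u.reverse.map some) s a n l r) :=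
    .single (by simp [program, setBit])
  exact ⟨{ v with bit := u.head? }, ⟨rfl, rfl, rfl, rfl, rfl⟩,
    (h1.trans (finish_reaches u.reverse)).of_eq rfl (by simp) (by simp; omega)⟩

theorem fetch_reaches (v : Reg) {a s : List (Option Bool)} :
    ReachesWithin (TM2.step program) 1 (cfg .fetch v p d b s a n l r)
      (cfg .quad { v with sym := r.head?.join, found := false } p d b s a n l r) :=
  .single (by simp [program])

theorem pass_none (v : Reg) (hM : M q r.head?.join = none) : ∃ v' : Reg, v'.found = false ∧
    ReachesWithin (TM2.step program) (passTime k)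
      (cfg .fetch v p (M.body.map some) [] ((encodeState (Nat.size k) q).map some) [] n l r)
      (cfg .finish v' p (M.body.map some) [] ((encodeState (Nat.size k) q).map some) [] n l r) := by
  have h1 := fetch_reaches (p := p) (d := M.body.map some) (b := []) (n := n) (l := l) (r := r)
    (a := []) (s := (encodeState (Nat.size k) q).map some) v
  obtain ⟨v2, hv2, h2⟩ := keys_skip (p := p) (d := []) (b := []) (n := n) (l := l) (r := r) M q
    { v with sym := r.head?.join, found := false } (keys k) (by rintro x - hx rfl; exact hx hM)
  obtain ⟨v3, hv3, h3⟩ := quad_finish (p := p) (n := n) (l := l) (r := r) (a := [])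
    (s := (encodeState (Nat.size k) q).map some) v2 M.body
  refine ⟨v3, by rw [hv3.found, hv2.found], ((h1.trans_eq h2 (by simp [body])).trans_eq h3
    (by simp [body])).mono ?_⟩
  -- The summands of `passTime` pay for scanning all keys, for moving the description back, and for
  -- the two steps that leave `fetch` and `quad`.
  have := M.length_body_le
  rw [length_keys]
  unfold passTime
  omega

/-- The current key occurs exactly once in `keys k`; splitting the list there gives a skip, a hit,
and a skip that leaves the recorded action untouched. -/
theorem pass_some (v : Reg) {q' : Fin (k + 1)} {a} (hM : M q r.head?.join = some (q', a)) :
    ∃ v' : Reg, v'.found = true ∧ v'.Holds a ∧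
    ReachesWithin (TM2.step program) (passTime k)
      (cfg .fetch v p (M.body.map some) [] ((encodeState (Nat.size k) q).map some) [] n l r)
      (cfg .finish v' p (M.body.map some) [] ((encodeState (Nat.size k) q).map some) []
        ((encodeState (Nat.size k) q').reverse.map some ++ n) l r) := by
  obtain ⟨L₁, L₂, hL⟩ := List.append_of_mem (mem_keys (q, r.head?.join))
  have hnd := nodup_keys (k := k)
  have hlen := length_keys (k := k)
  rw [hL, List.nodup_middle, List.nodup_cons] at hnd
  rw [hL, List.length_append, List.length_cons] at hlen
  have h1 := fetch_reaches (p := p) (d := M.body.map some) (b := []) (n := n) (l := l) (r := r)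
    (a := []) (s := (encodeState (Nat.size k) q).map some) v
  have hbody : M.body = L₁.flatMap (quadBits M (Nat.size k)) ++
      (quadBits M (Nat.size k) (q, r.head?.join) ++ L₂.flatMap (quadBits M (Nat.size k))) := by
    rw [body, hL, List.flatMap_append, List.flatMap_cons]
  obtain ⟨v2, hv2, h2⟩ := keys_skip (p := p) (b := []) (n := n) (l := l) (r := r)
    (d := (quadBits M (Nat.size k) (q, r.head?.join) ++
      L₂.flatMap (quadBits M (Nat.size k))).map some) M q
    { v with sym := r.head?.join, found := false } L₁
    (by rintro x hx - rfl; exact hnd.1 (by simp [hx]))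
  have hs2 : v2.sym = r.head?.join := hv2.sym
  obtain ⟨v3, ha3, hs3, hf3, h3⟩ := key_hit (p := p) (n := n) (l := l) (r := r)
    (d := (L₂.flatMap (quadBits M (Nat.size k))).map some)
    (b := (L₁.flatMap (quadBits M (Nat.size k))).reverse.map some) M q v2 (by rwa [hs2])
  obtain ⟨v4, hv4, h4⟩ := keys_skip (p := p) (d := []) (l := l) (r := r)
    (b := (quadBits M (Nat.size k) (q, r.head?.join)).reverse.map some ++
      (L₁.flatMap (quadBits M (Nat.size k))).reverse.map some)
    (n := (encodeState (Nat.size k) q').reverse.map some ++ n) M q v3 L₂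
    (by rw [hs3, hs2]; rintro x hx - rfl; exact hnd.1 (by simp [hx]))
  obtain ⟨v5, hv5, h5⟩ := quad_finish (p := p) (l := l) (r := r) (a := [])
    (n := (encodeState (Nat.size k) q').reverse.map some ++ n)
    (s := (encodeState (Nat.size k) q).map some) v4 M.body
  refine ⟨v5, by rw [hv5.found, hv4.found, hf3], (ha3.of_agree hv4).of_agree hv5, ?_⟩
  rw [hs2] at h3
  refine ((((h1.trans_eq h2 (by simp [hbody])).trans_eq h3 (by simp)).trans_eq h4
    (by simp)).trans_eq h5 (by simp [hbody])).mono ?_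
  have h7 := M.length_body_le
  have h8 : L₁.length * (2 * Nat.size k + 4) + (2 * Nat.size k + 4) +
      L₂.length * (2 * Nat.size k + 4) = 3 * (k + 1) * (2 * Nat.size k + 4) := by
    rw [← hlen]; ring
  unfold passTime
  omega

end UTM

/-! ## The whole simulation -/

namespace UTM

open BinTM

variable {p : List (Option Bool)} {k : ℕ}

/-- The stacks `l` and `r` represent the tape `T`, its head on top of `r`. -/
structure TapeRep (l r : List (Option Bool)) (T : Tape (Option Bool)) : Prop where
  left : ListBlank.mk l = T.left
  right : ListBlank.mk r = T.right₀

theorem TapeRep.head {l r : List (Option Bool)} {T} (h : TapeRep l r T) :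
    T.head = r.head?.join := by
  have := congrArg ListBlank.head h.right
  rw [Tape.right₀, ListBlank.head_cons, ListBlank.head_mk] at this
  rw [← this]
  cases r <;> rfl

theorem TapeRep.tail {l r : List (Option Bool)} {T} (h : TapeRep l r T) :
    ListBlank.mk r.tail = T.right := by
  have := congrArg ListBlank.tail h.right
  rwa [Tape.right₀, ListBlank.tail_cons, ListBlank.tail_mk] at this

theorem tapeRep_mk₁ (y : List (Option Bool)) : TapeRep [] y (Tape.mk₁ y) :=
  ⟨rfl, (Tape.mk'_right₀ _ _).symm⟩

/-- The effect of an action on a tape. -/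
def act : TM0.Stmt (Option Bool) → Tape (Option Bool) → Tape (Option Bool)
  | .move d, T => T.move d
  | .write a, T => T.write a

theorem apply_reaches (v : Reg) {d b s a n l r : List (Option Bool)} {st : TM0.Stmt (Option Bool)}
    (hv : v.Holds st) {T : Tape (Option Bool)} (h : TapeRep l r T) : ∃ v' l' r',
    TapeRep l' r' (act st T) ∧
    ReachesWithin (TM2.step program) 1 (cfg .apply v p d b s a n l r)
      (cfg .clear v' p d b s a n l' r') := by
  have hh := h.head
  have ht := h.tail
  have hl := h.left
  obtain ⟨o, key, sym, ok, found, a0, a1, a2⟩ := v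
  obtain (_ | _) | x := st
  · simp only [Reg.Holds, encodeAction, List.cons.injEq, and_true] at hv
    obtain ⟨rfl, rfl, rfl⟩ := hv
    refine ⟨_, l.tail, l.head?.join :: r, ⟨?_, ?_⟩, .single (by simp [program, setBit]; rfl)⟩
    · simp [act, Tape.move, ← hl]
    · rw [← ListBlank.cons_mk, h.right, act, Tape.move, Tape.right₀]
      congr 1
      rw [← hl]
      -- An empty stack pops as a blank, in agreement with the default head of a `ListBlank`.
      cases l <;> rfl
  · simp only [Reg.Holds, encodeAction, List.cons.injEq, and_true] at hv
    obtain ⟨rfl, rfl, rfl⟩ := hv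
    refine ⟨_, r.head?.join :: l, r.tail, ⟨?_, ?_⟩, .single (by simp [program, setBit]; rfl)⟩
    · rw [← ListBlank.cons_mk, hl, ← hh]
      rfl
    · rw [ht, act, Tape.move, Tape.right₀, ListBlank.cons_head_tail]
  · refine ⟨⟨r.head?.join, key, sym, ok, found, a0, a1, a2⟩, l, x :: r.tail, ⟨?_, ?_⟩, .single ?_⟩
    · simpa [act, Tape.write] using hl
    · rw [← ListBlank.cons_mk, ht]
      rfl
    · obtain _ | _ := x <;>
      · simp only [Reg.Holds, encodeAction, encodeSymbol, List.cons.injEq, and_true] at hv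
        obtain ⟨rfl, rfl, rfl⟩ := hv
        simp [program, setBit]

theorem finish_found (v : Reg) (hv : v.found = true) {d s a n l r : List (Option Bool)} :
    ReachesWithin (TM2.step program) 1 (cfg .finish v p d [] s a n l r)
      (cfg .apply { v with bit := none } p d [] s a n l r) :=
  .single (by simp [program, setBit, hv])

theorem haltsWithin_finish (v : Reg) (hv : v.found = false) (t : ℕ)
    {d s a n l r : List (Option Bool)} :
    haltsWithin (TM2.step program) (t + 1) (cfg .finish v p d [] s a n l r) =
      some ⟨none, { v with bit := none }, stackFn p d [] s a n l r⟩ := by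
  rw [haltsWithin_succ_of_some (c' := ⟨none, { v with bit := none }, stackFn p d [] s a n l r⟩)
    (by simp [program, setBit, hv])]
  exact haltsWithin_of_none rfl t

/-- The number of steps for the simulation of one step. -/
def stepTime (k : ℕ) : ℕ := passTime k + 2 * Nat.size k + 4

theorem step_reaches (M : BinTM k) (v : Reg) {l r : List (Option Bool)}
    {c c' : TM0.Cfg (Option Bool) (Fin (k + 1))} (hT : TapeRep l r c.Tape)
    (h : TM0.step M c = some c') : ∃ v' l' r', TapeRep l' r' c'.Tape ∧
    ReachesWithin (TM2.step program) (stepTime k)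
      (cfg .fetch v p (M.body.map some) [] ((encodeState (Nat.size k) c.q).map some) [] [] l r)
      (cfg .fetch v' p (M.body.map some) [] ((encodeState (Nat.size k) c'.q).map some) [] []
        l' r') := by
  obtain ⟨q, T⟩ := c
  simp only [TM0.step, Option.map_eq_some_iff] at h
  obtain ⟨⟨q', st⟩, hM, rfl⟩ := h
  replace hM : M q r.head?.join = some (q', st) := by rw [← hM, ← hT.head]
  obtain ⟨v1, hf, ha, h1⟩ := pass_some (p := p) (n := []) (l := l) M q v hM
  have h2 := finish_found (p := p) (d := M.body.map some) (l := l) (r := r) (a := [])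
    (s := (encodeState (Nat.size k) q).map some)
    (n := (encodeState (Nat.size k) q').reverse.map some ++ []) v1 hf
  obtain ⟨v3, l', r', hT', h3⟩ := apply_reaches (p := p) (d := M.body.map some) (b := []) (a := [])
    (s := (encodeState (Nat.size k) q).map some)
    (n := (encodeState (Nat.size k) q').reverse.map some) { v1 with bit := none }
    (ha.of_agree (v' := { v1 with bit := none }) ⟨rfl, rfl, rfl, rfl, rfl⟩) hT
  have h4 := clear_reaches (p := p) (d := M.body.map some) (b := []) (a := []) (l := l') (r := r')
    (n := (encodeState (Nat.size k) q').reverse.map some) (v := v3) (encodeState (Nat.size k) q)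
  have h5 := install_reaches (p := p) (d := M.body.map some) (b := []) (a := []) (l := l')
    (r := r') (s := []) (v := { v3 with bit := none }) (encodeState (Nat.size k) q').reverse
  refine ⟨_, l', r', ?_, ((((h1.trans h2).trans_eq h3 (by simp)).trans h4).trans h5).of_eq rfl
    (by simp; rfl) ?_⟩
  · cases st <;> exact hT'
  -- One pass, one step each for `finish` and `apply`, and `Nat.size k + 1` each for `clear` and
  -- `install`.
  · simp [stepTime]
    omega

/-- The factor is `t + 1` because a last pass, finding no quadruple, is needed to detect halting. -/
theorem haltsWithin_simulation (M : BinTM k) (t : ℕ) (v : Reg) {l r : List (Option Bool)}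
    {c d : TM0.Cfg (Option Bool) (Fin (k + 1))} (hT : TapeRep l r c.Tape)
    (h : haltsWithin (TM0.step M) t c = some d) : ∃ d', TapeRep (d'.stk .left) (d'.stk .right) d.Tape ∧
    haltsWithin (TM2.step program) ((t + 1) * stepTime k)
      (cfg .fetch v p (M.body.map some) [] ((encodeState (Nat.size k) c.q).map some) [] [] l r) =
      some d' := by
  cases hs : TM0.step M c with
  | none =>
    rw [haltsWithin_of_none hs, Option.some_inj] at h
    subst h
    obtain ⟨q, T⟩ := c
    simp only [TM0.step, Option.map_eq_none_iff] at hs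
    obtain ⟨v1, hf, h1⟩ := pass_none (p := p) (n := []) (l := l) (r := r) M q v
      (by rw [← hs, ← hT.head])
    refine ⟨_, ?_, haltsWithin_mono ?_ (h1 _ _ (haltsWithin_finish v1 hf 0))⟩
    · simpa using hT
    · rw [stepTime]
      nlinarith
  | some c' =>
    cases t with
    | zero => simp [haltsWithin, hs] at h
    | succ t =>
      rw [haltsWithin_succ_of_some hs] at h
      obtain ⟨v', l', r', hT', h1⟩ := step_reaches (p := p) M v hT hs
      obtain ⟨d', hd', h2⟩ := haltsWithin_simulation M t v' hT' h
      exact ⟨d', hd', haltsWithin_mono (by linarith) (h1 _ _ h2)⟩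

theorem run_selfDelim (M : BinTM k) {t : ℕ} {y out : List Bool} (h : M.run t y = some out)
    (rest : List Bool) {T : ℕ}
    (hT : 2 * M.encode.length + Nat.size k + 3 + (t + 1) * stepTime k ≤ T) :
    run T (selfDelim M.encode ++ rest) y = some out := by
  simp only [BinTM.run, Option.map_eq_some_iff] at h
  obtain ⟨d, hd, rfl⟩ := h
  obtain ⟨o, p', h1⟩ := parse_reaches (v := Reg.init) (d := []) (b := []) (s := []) (a := [])
    (n := []) (l := []) (r := y.map some) M.encode rest
  have h2 := rewind_reaches (v := { Reg.init with bit := o }) (d := []) (s := []) (a := [])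
    (n := []) (l := []) (r := y.map some) (p := p') M.encode.reverse
  have h3 := header_reaches (v := { Reg.init with bit := none }) (d := M.body.map some) (s := [])
    (a := []) (n := []) (l := []) (r := y.map some) (p := p') (b := []) (Nat.size k)
  obtain ⟨d', hd', h4⟩ := haltsWithin_simulation (p := p') M t
    { Reg.init with bit := some false } (tapeRep_mk₁ (y.map some)) hd
  -- The `w` zeros left on `state` by the header loop are the name of the initial state `0`.
  have h0 : encodeState (Nat.size k) ((TM0.init (y.map some) :
      TM0.Cfg (Option Bool) (Fin (k + 1))).q : ℕ) = List.replicate (Nat.size k) false := by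
    simp only [TM0.init, Fin.default_eq_zero, Fin.val_zero, encodeState]
    rw [List.eq_replicate_iff]
    simp
  rw [h0] at h4
  have h5 := ((h1.trans_eq h2 (by simp)).trans_eq h3 (by simp [encode_eq])) _ _
    ((congrArg (fun s => haltsWithin (TM2.step program) ((t + 1) * stepTime k) (cfg .fetch
      { Reg.init with bit := some false } p' (M.body.map some) [] s [] [] [] (y.map some)))
      (List.append_nil _)).trans h4)
  have hi : init (selfDelim M.encode ++ rest) y = cfg .parse Reg.init
      ((selfDelim M.encode ++ rest).map some) [] [] [] [] [] [] (y.map some) := by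
    simp only [init, cfg]
    congr 1
    funext k
    cases k <;> rfl
  rw [run, hi, haltsWithin_mono (t' := T) ?_ h5]
  · rw [Option.map_some, ← hd'.right]
    rfl
  · simp
    omega

end UTM

/-! ## Removing the states that are not visited -/

namespace BinTM

variable {k : ℕ}

/-- A halting computation of at most `t` steps visits a set `S` of at most `t + 1` states, and it is
not affected by a renaming of the states in `S`. -/
theorem exists_visited (M : BinTM k) (t : ℕ) {c d : TM0.Cfg (Option Bool) (Fin (k + 1))}
    (h : haltsWithin (TM0.step M) t c = some d) :
    ∃ S : Finset (Fin (k + 1)), S.card ≤ t + 1 ∧ c.q ∈ S ∧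
      ∀ (k' : ℕ) (M' : BinTM k') (f : Fin (k' + 1) → Fin (k + 1)),
        (∀ q s, M (f q) s = none → M' q s = none) →
        (∀ q s r a, M (f q) s = some (r, a) → r ∈ S → ∃ r', f r' = r ∧ M' q s = some (r', a)) →
        ∀ q, f q = c.q → ∃ q', haltsWithin (TM0.step M') t ⟨q, c.Tape⟩ = some ⟨q', d.Tape⟩ := by
  cases hs : TM0.step M c with
  | none =>
    rw [haltsWithin_of_none hs, Option.some_inj] at h
    subst h
    obtain ⟨q₀, T⟩ := c
    refine ⟨{q₀}, by simp, by simp, fun k' M' f h1 _ q hq => ⟨q, haltsWithin_of_none ?_ t⟩⟩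
    simp only [TM0.step, Option.map_eq_none_iff] at hs ⊢
    exact h1 _ _ (hq ▸ hs)
  | some c' =>
    cases t with
    | zero => simp [haltsWithin, hs] at h
    | succ t =>
      rw [haltsWithin_succ_of_some hs] at h
      obtain ⟨S, hS, hc', H⟩ := exists_visited M t h
      -- The condition on `M'` for a larger set implies that for `S`, so the inductive statement
      -- applies to the rest of the run.
      refine ⟨insert c.q S, (Finset.card_insert_le _ _).trans (by omega), by simp,
        fun k' M' f h1 h2 q hq => ?_⟩
      obtain ⟨q₀, T⟩ := c
      simp only [TM0.step, Option.map_eq_some_iff] at hs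
      obtain ⟨⟨r, a⟩, hM, rfl⟩ := hs
      obtain ⟨r', hr', hM'⟩ := h2 q T.head r a (by rw [hq]; exact hM)
        (Finset.mem_insert_of_mem hc')
      obtain ⟨q', hq'⟩ := H k' M' f h1
        (fun q s r a hM hr => h2 q s r a hM (Finset.mem_insert_of_mem hr)) r' hr'
      exact ⟨q', (haltsWithin_succ_of_some (by simp only [TM0.step, hM']; rfl) t).trans hq'⟩

/-- An exact count, rather than a bound, allows two machines to be compared quadruple by quadruple.
-/
theorem length_body_eq_sum (M : BinTM k) : M.body.length =
    ∑ q, ∑ s : Option Bool, if (M q s).isSome then 2 * Nat.size k + 5 else 0 := by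
  have h (x : Fin (k + 1) × Option Bool) : (M.quadBits (Nat.size k) x).length =
      if (M x.1 x.2).isSome then 2 * Nat.size k + 5 else 0 := by
    unfold quadBits
    split <;> simp [*, length_encodeAction]
    omega
  rw [body, List.length_flatMap, List.map_congr_left fun x _ => h x, ← List.sum_toFinset _ nodup_keys,
    ← Fintype.sum_prod_type']
  exact Finset.sum_congr (Finset.eq_univ_of_forall fun x => by simp [mem_keys]) fun _ _ => rfl

theorem length_encode (M : BinTM k) : M.encode.length = Nat.size k + 1 + M.body.length := by
  rw [encode_eq]
  simp
  omega

/-- A machine that halts within `t` steps on an input can be replaced for this input by one with at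
most `t + 1` states and no longer a description. -/
theorem exists_small (M : BinTM k) {t : ℕ} {y out : List Bool} (h : M.run t y = some out) :
    ∃ (k' : ℕ) (M' : BinTM k'), k' ≤ t ∧ M'.encode.length ≤ M.encode.length ∧
      M'.run t y = some out := by
  classical
  simp only [run, Option.map_eq_some_iff] at h
  obtain ⟨d, hd, rfl⟩ := h
  obtain ⟨S, hS, h0, H⟩ := exists_visited M t hd
  replace h0 : 0 ∈ S := h0
  obtain ⟨k', hk'⟩ : ∃ k', S.card = k' + 1 :=
    Nat.exists_eq_succ_of_ne_zero (Finset.card_ne_zero_of_mem h0)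
  -- The increasing enumeration of `S` keeps the initial state in place, `0` being the least element
  -- of `S`.
  let f := S.orderEmbOfFin hk'
  have hf0 : f 0 = 0 := by
    have : f 0 = S.min' ⟨0, h0⟩ := Finset.orderEmbOfFin_zero hk' (Nat.succ_pos _)
    rw [this]
    exact le_antisymm (Finset.min'_le _ _ h0) (Fin.zero_le _)
  have hex (r) (hr : r ∈ S) : ∃ r', f r' = r := by
    have : r ∈ Set.range f := by rw [Finset.range_orderEmbOfFin]; exact hr
    exact this
  -- Transitions that leave `S` are dropped; the run never uses them.
  let M' : BinTM k' := fun q s => (M (f q) s).bind fun x =>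
    if hx : x.1 ∈ S then some ((hex x.1 hx).choose, x.2) else none
  have hkk : k' ≤ k := by
    have := Finset.card_le_univ S
    simp only [Fintype.card_fin] at this
    omega
  refine ⟨k', M', by omega, ?_, ?_⟩
  · have hsz := Nat.size_le_size hkk
    rw [length_encode, length_encode, length_body_eq_sum, length_body_eq_sum]
    refine Nat.add_le_add (by omega) ?_
    -- State names do not get longer, and since `f` is injective, distinct quadruples of `M'` come
    -- from distinct quadruples of `M`.
    calc ∑ q, ∑ s : Option Bool, (if (M' q s).isSome then 2 * Nat.size k' + 5 else 0)
        ≤ ∑ q, ∑ s : Option Bool, (if (M (f q) s).isSome then 2 * Nat.size k + 5 else 0) := by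
          refine Finset.sum_le_sum fun q _ => Finset.sum_le_sum fun s _ => ?_
          cases hM : M (f q) s with
          | none => simp [M', hM]
          | some x => simp only [Option.isSome_some, if_true]; split_ifs <;> omega
      _ = ∑ q ∈ Finset.univ.map f.toEmbedding,
            ∑ s : Option Bool, (if (M q s).isSome then 2 * Nat.size k + 5 else 0) := by
          rw [Finset.sum_map]; rfl
      _ ≤ _ := Finset.sum_le_univ_sum_of_nonneg fun _ => Nat.zero_le _
  · obtain ⟨q', hq'⟩ := H k' M' f (fun q s hM => by simp [M', hM])
      (fun q s r a hM hr => ⟨(hex r hr).choose, (hex r hr).choose_spec, by simp [M', hM, hr]⟩) 0 hf0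
    -- The output depends on the final tape only, so the renamed final state does not matter.
    exact congrArg (Option.map _) hq'

end BinTM

/-! ## The probability of a program -/

theorem UTM.length_selfDelim (l : List Bool) : (UTM.selfDelim l).length = 2 * l.length + 1 := by
  simp [UTM.selfDelim, List.length_flatMap, mul_comm]

/-- A larger depth bound only replaces the output `⊥` by samples. -/
theorem QU_mono {t T : ℕ} (h : t ≤ T) (c x : List Bool) : QU t c (some x) ≤ QU T c (some x) := by
  unfold QU
  split
  · split_ifs
    · exact le_rfl
    · omega
    · simp
    · exact le_rfl
  · exact le_rfl

/-- The programs that extend `u` have probability `2 ^ (-|u|)`. -/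
theorem le_universalSampler {T n : ℕ} {u : List Bool} {z : Option (List Bool)} {P : ℝ≥0∞}
    (hu : u.length ≤ T)
    (h : ∀ rest, P ≤ QU' T (UTM.run T (u ++ rest) (List.replicate n true)) z) :
    (2 ^ u.length)⁻¹ * P ≤ universalSampler T n z := by
  obtain ⟨m, rfl⟩ := Nat.exists_eq_add_of_le hu
  let g (s : Fin m → Bool) : Fin (u.length + m) → Bool := Fin.append u.get s
  have hg (s) : List.ofFn (g s) = u ++ List.ofFn s := by
    simp [g, List.ofFn_fin_append]
  have hinj : Function.Injective g := fun s s' hs => by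
    have := congrArg List.ofFn hs
    rw [hg, hg] at this
    exact List.ofFn_injective (List.append_cancel_left this)
  rw [universalSampler, PMF.bind_apply]
  refine le_trans ?_ (ENNReal.tsum_comp_le_tsum_of_injective hinj _)
  simp only [hg, PMF.uniformOfFintype_apply]
  refine le_trans ?_ (ENNReal.tsum_le_tsum fun s => mul_le_mul_right (h (List.ofFn s)) _)
  rw [tsum_fintype, Finset.sum_const, nsmul_eq_mul, ← mul_assoc]
  refine mul_le_mul_left (le_of_eq ?_) _
  simp only [Finset.card_univ, Fintype.card_pi, Fintype.card_bool, Finset.prod_const,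
    Fintype.card_fin, Nat.cast_pow, Nat.cast_ofNat]
  -- There are `2 ^ m` extensions, each of probability `2 ^ -(|u| + m)`.
  rw [pow_add, ENNReal.mul_inv (by simp) (by simp), mul_left_comm,
    ENNReal.mul_inv_cancel (by simp) (by simp), mul_one]

/-! ## The logarithm -/

theorem log₂_mono : Monotone log₂ := fun _ _ h =>
  EReal.div_le_div_right_of_nonneg (by exact_mod_cast Real.log_nonneg (by norm_num))
    (ENNReal.log_monotone h)

theorem log₂_inv (a : ℝ≥0∞) : log₂ a⁻¹ = -log₂ a := by
  rw [log₂, log₂, ENNReal.log_inv, EReal.div_eq_inv_mul, EReal.div_eq_inv_mul, mul_neg]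

/-- The added term is finite, so the identity survives `a = 0` and `a = ∞`; the latter occurs when
the algorithm never outputs `x`. -/
theorem log₂_two_pow_mul (N : ℕ) (a : ℝ≥0∞) : log₂ (2 ^ N * a) = log₂ a + (N : EReal) := by
  have h2 : ENNReal.log 2 = (Real.log 2 : ℝ) := by
    simpa using ENNReal.log_ofReal_of_pos (x := 2) (by norm_num)
  have hpos : 0 < Real.log 2 := Real.log_pos (by norm_num)
  have hN : ENNReal.log (2 ^ N) = ((N * Real.log 2 : ℝ) : EReal) := by
    rw [ENNReal.log_pow, h2]
    norm_cast
  rw [log₂, ENNReal.log_mul_add, hN, add_comm, log₂,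
    EReal.add_div_of_nonneg_right (by exact_mod_cast hpos.le), ← EReal.coe_div,
    mul_div_cancel_right₀ _ hpos.ne', EReal.coe_natCast]

/-! ## The coding theorem -/

theorem simulation_bound {k t T : ℕ} (hk : k ≤ t) (hT : 100 * (t + 1) ^ 3 < T) (M : BinTM k) :
    2 * M.encode.length + Nat.size k + 3 + (t + 1) * UTM.stepTime k ≤ T := by
  -- This crude bound makes a step cost `O(t ^ 2)` and the simulation `O(t ^ 3)`; the constant `100`
  -- is generous.
  have hw : Nat.size k ≤ t := (Nat.size_le.2 k.lt_two_pow_self).trans hk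
  have hb : M.body.length ≤ 3 * (t + 1) * (2 * t + 5) := M.length_body_le.trans (by gcongr)
  have hs : UTM.stepTime k ≤
      3 * (t + 1) * (2 * t + 4) + 3 * (t + 1) * (2 * t + 5) + 2 + 2 * t + 4 := by
    unfold UTM.stepTime UTM.passTime
    gcongr
  have := Nat.mul_le_mul_left (t + 1) hs
  rw [M.length_encode]
  nlinarith [Nat.zero_le (t ^ 2), Nat.zero_le (t ^ 3)]

theorem mainTheorem7 :
    ∃ (c : ℕ) (t₀ : Polynomial ℕ),
      ∀ (t : ℕ → ℕ) (D : QuantumAlgorithm t) (n : ℕ) (x : List Bool) (T : ℕ),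
        t₀.eval (t n) < T →
          quK T x n ≤ log₂ (1 / D.sample n (some x)) + ((2 * D.size + c : ℕ) : EReal) := by
  -- The constant `1` is the terminating `0` of the self-delimiting form.
  refine ⟨1, Polynomial.C 100 * (Polynomial.X + 1) ^ 3, fun t D n x T hT => ?_⟩
  simp only [Polynomial.eval_mul, Polynomial.eval_C, Polynomial.eval_pow, Polynomial.eval_add,
    Polynomial.eval_X, Polynomial.eval_one] at hT
  obtain ⟨out, hout⟩ := Option.isSome_iff_exists.1 (D.halts n)
  obtain ⟨k, M, hk, hM, hrun⟩ := D.machine.exists_small hout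
  have hbound := simulation_bound hk hT M
  have hlen := UTM.length_selfDelim M.encode
  have htT : t n ≤ T := by nlinarith [Nat.zero_le (t n ^ 2), Nat.zero_le (t n ^ 3)]
  have hP : D.sample n = QU (t n) out := by
    rw [QuantumAlgorithm.sample, hout]
    rfl
  have key := le_universalSampler (T := T) (n := n) (u := UTM.selfDelim M.encode) (z := some x)
    (P := D.sample n (some x)) (by omega) fun rest => by
      rw [UTM.run_selfDelim M hrun rest hbound, hP]
      exact QU_mono htT out x
  have hinv := ENNReal.inv_le_inv.2 key
  rw [ENNReal.mul_inv (by simp) (by simp), inv_inv, ← one_div (D.sample n (some x))] at hinv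
  rw [quK, ← log₂_inv]
  refine (log₂_mono hinv).trans ?_
  rw [log₂_two_pow_mul, hlen]
  -- What remains is that the reduced machine has no longer a description than the original.
  gcongr
  exact hM
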